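/- Conventions. A structure with one binary relation is a digraph: a set $X$ with a relation $R^{\mathbf X}\subseteq X^2$. A homomorphism $\mathbf X\to\mathbf A$ is a map $h:X\to A$ with $(h(x),h(y))\in R^{\mathbf A}$ for all $(x,y)\in R^{\mathbf X}$; we write $\mathbf X\to\mathbf A$ if one exists. For a positive integer $p$, the clique $\mathbf K_p$ has domain of size $p$ and relation $\{(a,b):a\ne b\}$. An instance of (the decision version of) $\mathrm{PCSP}(\mathbf A,\mathbf B)$ is a finite digraph $\mathbf X$ such that $\mathbf X\to\mathbf A$ or $\mathbf X\not\to\mathbf B$. For a positive integer $k$, a finite digraph $\mathbf X$ and a finite digraph $\mathbf A$, we say that $\mathrm{SA}^k(\mathbf X,\mathbf A)$ (the $k$-th level of the Sherali–Adams linear programming hierarchy) accepts if there are real numbers in $[0,1]$: $\lambda_V(f)$ for every $V\subseteq X$ with $1\le|V|\le k$ and every $f:V\to A$, and $\lambda_{\vec x}(f)$ for every $\vec x=(x_1,x_2)\in R^{\mathbf X}$ and every $f:\{x_1,x_2\}\to A$, such that 1. $\sum_{f:V\to A}\lambda_V(f)=1$ for all $V\subseteq X$ with $1\le|V|\le k$;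 2. $\lambda_U(f)=\sum_{g:V\to A,\ g|_U=f}\lambda_V(g)$ for all $\emptyset\neq U\subseteq V\subseteq X$ with $|V|\le k$ and all $f:U\to A$; 3. $\lambda_U(f)=\sum_{g:\{x_1,x_2\}\to A,\ g|_U=f}\lambda_{\vec x}(g)$ for all $\vec x=(x_1,x_2)\in R^{\mathbf X}$, all $U\subseteq\{x_1,x_2\}$ with $1\le|U|\le k$ and all $f:U\to A$; 4. $\lambda_{\vec x}(f)=0$ for all $\vec x=(x_1,x_2)\in R^{\mathbf X}$ and all $f:\{x_1,x_2\}\to A$ with $(f(x_1),f(x_2))\notin R^{\mathbf A}$. We say that $\mathrm{SA}^k$ solves $\mathrm{PCSP}(\mathbf A,\mathbf B)$ if for every instance $\mathbf X$ of $\mathrm{PCSP}(\mathbf A,\mathbf B)$: (i) if $\mathbf X\to\mathbf A$ then $\mathrm{SA}^k(\mathbf X,\mathbf A)$ accepts, and (ii) if $\mathrm{SA}^k(\mathbf X,\mathbf A)$ accepts then $\mathbf X\to\mathbf B$. Theorem. No constant level of Sherali–Adams solves the approximate graph colouring problem: for all integers $3\le c\le d$ there is no positive integer $k$ such that $\mathrm{SA}^k$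 solves $\mathrm{PCSP}(\mathbf K_c,\mathbf K_d)$. -/

import Mathlib

open FirstOrder FirstOrder.Language FirstOrder.Language.Structure

namespace SheraliAdams

/-- The set `{x₁, …, xₙ}` of entries of a tuple `x`. -/
def entries {X : Type*} [DecidableEq X] {n : ℕ} (x : Fin n → X) : Finset X :=
  Finset.univ.image x

theorem mem_entries {X : Type*} [DecidableEq X] {n : ℕ} (x : Fin n → X) (i : Fin n) :
    x i ∈ entries x :=
  Finset.mem_image_of_mem x (Finset.mem_univ i)

/-- The restriction of a map `g : V → A` to a subset `U ⊆ V`. -/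
def restr {X A : Type*} {U V : Finset X} (h : U ⊆ V) (g : V → A) : U → A :=
  fun u => g ⟨u, h u.2⟩

/-- The image tuple `f(x) = (f(x₁), …, f(xₙ))` of a tuple `x` under a map
`f : {x₁, …, xₙ} → A`. -/
def applyTuple {X A : Type*} [DecidableEq X] {n : ℕ} (x : Fin n → X) (f : entries x → A) :
    Fin n → A :=
  fun i => f ⟨x i, mem_entries x i⟩

/-- `IsSolution L k lam lamR` says that the values `lam V f` (for `V ⊆ X`, `1 ≤ |V| ≤ k`,
`f : V → A`) and `lamR R x f` (for a relation symbol `R`, a tuple `x ∈ R^X` and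
`f : {x} → A`) form a solution in `[0, 1]` of the `k`-th level of the Sherali-Adams linear
program for the structures `X` and `A` over the relational signature `L`.
Values of `lam` and `lamR` at other arguments are not variables of the program, and nothing is
required of them. -/
structure IsSolution (L : Language) (k : ℕ) {X A : Type*} [DecidableEq X] [Fintype A]
    [DecidableEq A] [L.Structure X] [L.Structure A]
    (lam : (V : Finset X) → (V → A) → ℝ)
    (lamR : {n : ℕ} → (R : L.Relations n) → (x : Fin n → X) → (entries x → A) → ℝ) : Prop where
  lam_mem : ∀ (V : Finset X), 1 ≤ V.card → V.card ≤ k → ∀ f : V → A,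
    lam V f ∈ Set.Icc (0 : ℝ) 1
  lamR_mem : ∀ {n : ℕ} (R : L.Relations n) (x : Fin n → X), RelMap R x →
    ∀ f : entries x → A, lamR R x f ∈ Set.Icc (0 : ℝ) 1
  sa1 : ∀ (V : Finset X), 1 ≤ V.card → V.card ≤ k → ∑ f : V → A, lam V f = 1
  sa2 : ∀ (U V : Finset X) (h : U ⊆ V), 1 ≤ U.card → V.card ≤ k → ∀ f : U → A,
    lam U f = ∑ g : V → A with restr h g = f, lam V g
  sa3 : ∀ {n : ℕ} (R : L.Relations n) (x : Fin n → X), RelMap R x →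
    ∀ (U : Finset X) (h : U ⊆ entries x), 1 ≤ U.card → U.card ≤ k → ∀ f : U → A,
    lam U f = ∑ g : entries x → A with restr h g = f, lamR R x g
  sa4 : ∀ {n : ℕ} (R : L.Relations n) (x : Fin n → X), RelMap R x →
    ∀ f : entries x → A, ¬ RelMap R (applyTuple x f) → lamR R x f = 0

/-- `SA^k(X, A)` accepts: the `k`-th level of the Sherali-Adams linear program is feasible. -/
def Accepts (L : Language) (k : ℕ) (X A : Type*) [DecidableEq X] [Fintype A]
    [DecidableEq A] [L.Structure X] [L.Structure A] : Prop :=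
  ∃ (lam : (V : Finset X) → (V → A) → ℝ)
    (lamR : {n : ℕ} → (R : L.Relations n) → (x : Fin n → X) → (entries x → A) → ℝ),
    IsSolution L k lam lamR

/-- Existence of a homomorphism `X → A` of structures over the relational signature `L`. -/
def HomTo (L : Language) (X A : Type*) [L.Structure X] [L.Structure A] : Prop :=
  Nonempty (X →[L] A)

/-- `X` is an instance of the (decision version of the) promise constraint satisfaction problem
`PCSP(A, B)`: a structure fulfilling the promise that `X → A` or `X ↛ B`. -/
def IsInstance (L : Language) (X A B : Type*) [L.Structure X] [L.Structure A]
    [L.Structure B] : Prop :=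
  HomTo L X A ∨ ¬ HomTo L X B

/-- `SA^k` solves `PCSP(A, B)`: for every finite instance `X`, if `X → A` then `SA^k(X, A)`
accepts, and if `SA^k(X, A)` accepts then `X → B`. -/
def Solves (L : Language) [L.IsRelational] (k : ℕ) (A B : Type*) [Fintype A] [DecidableEq A]
    [L.Structure A] [L.Structure B] : Prop :=
  ∀ (X : Type) [Finite X] [DecidableEq X] [L.Structure X], IsInstance L X A B →
    (HomTo L X A → Accepts L k X A) ∧ (Accepts L k X A → HomTo L X B)

/-- The vertex set `{0, …, p - 1}` of the clique `K_p`. -/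
abbrev Clique (p : ℕ) : Type := Fin p

/-- The clique `K_p` as a structure with one binary relation, `{(a, b) | a ≠ b}`. -/
instance cliqueStructure (p : ℕ) : Language.graph.Structure (Clique p) :=
  (⊤ : SimpleGraph (Fin p)).structure

end SheraliAdams

namespace SheraliAdams

/-! The instance is a shift graph on `n`-tuples over a large `Fin N`. A Ramsey-type argument shows
that it is not `d`-colourable (`exists_not_homTo_clique`), yet it looks 3-colourable locally: few
vertices involve at most `M` entries, and over `Fin M` three colours suffice
(`exists_shiftColorable_three`). Renaming the entries injectively into `Fin M` by a uniformly random
map and colouring there gives local distributions independent of the chosen renaming, hence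
consistent ones. As random renaming destroys order, `ShiftColorable` asks for all injective tuples,
not only increasing ones. -/

/-- There is a map on `n`-tuples over `Fin M` that gives different values to the two windows of
length `n` of each injective `(n + 1)`-tuple. -/
def ShiftColorable (n M : ℕ) (C : Type) : Prop :=
  ∃ φ : (Fin n → Fin M) → C, ∀ z : Fin (n + 1) → Fin M, Function.Injective z →
    φ (fun i => z i.castSucc) ≠ φ (fun i => z i.succ)

theorem shiftColorable_one (M : ℕ) : ShiftColorable 1 M (Fin M) :=
  ⟨fun x => x 0, fun z hz h => by simpa using hz h⟩

theorem ShiftColorable.comp {n M : ℕ} {C D : Type} (h : ShiftColorable n M C) {e : C → D}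
    (he : Function.Injective e) : ShiftColorable n M D := by
  obtain ⟨φ, hφ⟩ := h
  exact ⟨fun x => e (φ x), fun z hz h => hφ z hz (he h)⟩

/-- Replacing colours by the members of an antichain of sets lengthens the tuples by one. -/
theorem ShiftColorable.succ_of_antichain {n M : ℕ} {C D : Type} [Nonempty D]
    (h : ShiftColorable n M C) (S : C → Finset D)
    (hS : ∀ a b, a ≠ b → ∃ x ∈ S a, x ∉ S b) : ShiftColorable (n + 1) M D := by
  classical
  obtain ⟨ψ, hψ⟩ := h
  choose! g hg hg' using hS
  -- Each tuple gets an element of its first window's set missing from the second's. Equal colours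
  -- on overlapping tuples would lie both outside and inside the set of the shared window.
  refine ⟨fun x => g (ψ fun i => x i.castSucc) (ψ fun i => x i.succ), fun z hz h => ?_⟩
  have h1 := hψ (fun i => z i.castSucc) (hz.comp (Fin.castSucc_injective _))
  have h2 := hψ (fun i => z i.succ) (hz.comp (Fin.succ_injective _))
  apply hg' _ _ h1
  rw [show g (ψ fun i => z i.castSucc.castSucc) (ψ fun i => z i.succ.castSucc) = _ from h]
  exact hg _ _ h2

theorem ShiftColorable.succ_of_choose {n M c : ℕ} (hc : 0 < c)
    (h : ShiftColorable n M (Fin (c.choose 2))) : ShiftColorable (n + 1) M (Fin c) := by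
  have : Nonempty (Fin c) := ⟨⟨0, hc⟩⟩
  have hcard : Fintype.card {s : Finset (Fin c) // s.card = 2} = c.choose 2 := by
    simp
  let e := (Fintype.equivFinOfCardEq hcard).symm
  refine h.succ_of_antichain (fun a => (e a).1) fun a b hab => ?_
  by_contra! hsub
  apply hab
  apply e.injective
  apply Subtype.ext
  exact Finset.eq_of_subset_of_card_le hsub (by rw [(e a).2, (e b).2])

theorem shiftColorable_iterate (j : ℕ) : ∀ c : ℕ, 4 ≤ c →
    ShiftColorable (j + 1) ((fun a => a.choose 2)^[j] c) (Fin c) := by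
  induction j with
  | zero => exact fun c _ => shiftColorable_one c
  | succ j ih =>
    intro c hc
    refine ShiftColorable.succ_of_choose (by lia) (ih _ ?_)
    calc 4 ≤ Nat.choose 4 2 := by decide
      _ ≤ c.choose 2 := Nat.choose_le_choose 2 hc

/-- Four colours can be traded for three by lengthening the tuples by two. -/
theorem ShiftColorable.three_of_four {n M : ℕ} (h : ShiftColorable n M (Fin 4)) :
    ShiftColorable (n + 2) M (Fin 3) := by
  have key : ∃ g : Fin 4 → Fin 4 → Fin 4 → Fin 3,
      ∀ a b c d, a ≠ b → b ≠ c → c ≠ d → g a b c ≠ g b c d := by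
    -- Colours 0, 1, 2 stay; colour 3 becomes the least colour absent from both neighbours, which
    -- are not 3 themselves.
    refine ⟨fun a b c => if b = 0 then 0 else if b = 1 then 1 else if b = 2 then 2 else
      if a ≠ 0 ∧ c ≠ 0 then 0 else if a ≠ 1 ∧ c ≠ 1 then 1 else 2, by decide⟩
  obtain ⟨g, hg⟩ := key
  obtain ⟨ψ, hψ⟩ := h
  refine ⟨fun x => g (ψ fun i => x i.castSucc.castSucc) (ψ fun i => x i.succ.castSucc)
    (ψ fun i => x i.succ.succ), fun z hz => ?_⟩
  exact hg _ _ _ _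
    (hψ (fun i => z i.castSucc.castSucc)
      (hz.comp ((Fin.castSucc_injective _).comp (Fin.castSucc_injective _))))
    (hψ (fun i => z i.succ.castSucc)
      (hz.comp ((Fin.castSucc_injective _).comp (Fin.succ_injective _))))
    (hψ (fun i => z i.succ.succ)
      (hz.comp ((Fin.succ_injective _).comp (Fin.succ_injective _))))

/-- Growth needs a start of at least 4, since `Nat.choose 3 2 = 3`; hence the detour through four
colours. -/
theorem add_four_le_iterate_choose (j : ℕ) : j + 4 ≤ (fun a => a.choose 2)^[j] 4 := by
  induction j with
  | zero => rfl
  | succ j ih =>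
    rw [Function.iterate_succ_apply']
    refine le_trans ?_ (Nat.choose_le_choose 2 ih)
    have h : (j + 4).choose 2 = (j + 3) + (j + 3).choose 2 := by
      simp [Nat.choose_succ_succ' (j + 3) 1]
    have : (j + 3).choose 2 = (j + 2) + (j + 2).choose 2 := by
      simp [Nat.choose_succ_succ' (j + 2) 1]
    lia

/-- Three colours suffice for tuples over a ground set much larger than their length. -/
theorem exists_shiftColorable_three (K : ℕ) :
    ∃ n M : ℕ, 0 < n ∧ K * n ≤ M ∧ ShiftColorable n M (Fin 3) := by
  -- With `n = 2K + 4`, the last binomial step gives `M ≥ n(n - 1)/2`, and `(n - 1)/2 ≥ K`.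
  refine ⟨2 * K + 4, (fun a => a.choose 2)^[2 * K + 1] 4, by lia, ?_,
    (shiftColorable_iterate (2 * K + 1) 4 le_rfl).three_of_four⟩
  rw [Function.iterate_succ_apply']
  refine le_trans ?_ (Nat.choose_le_choose 2 (add_four_le_iterate_choose (2 * K)))
  rw [Nat.choose_two_right, Nat.le_div_iff_mul_le two_pos]
  have : 2 * K + 4 - 1 = 2 * K + 3 := by lia
  rw [this]
  nlinarith

/-! ### Shift graphs of large chromatic number -/

/-- Over a large enough linear order, every colouring of the `(n + 1)`-tuples gives the same colour
to the two windows of some strictly increasing `(n + 2)`-tuple. -/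
theorem exists_strictMono_window_eq (n : ℕ) : ∀ (C : Type) [Finite C], ∃ N : ℕ,
    ∀ f : (Fin (n + 1) → Fin N) → C, ∃ z : Fin (n + 2) → Fin N, StrictMono z ∧
      f (fun i => z i.castSucc) = f (fun i => z i.succ) := by
  induction n with
  | zero =>
    intro C _
    refine ⟨Nat.card C + 1, fun f => ?_⟩
    have := Fintype.ofFinite C
    obtain ⟨a, b, hab, h⟩ := Fintype.exists_ne_map_eq_of_card_lt
      (fun a : Fin (Nat.card C + 1) => f fun _ => a) (by simp [Nat.card_eq_fintype_card])
    wlog hlt : a < b generalizing a b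
    · exact this b a hab.symm h.symm (lt_of_le_of_ne (not_lt.mp hlt) hab.symm)
    refine ⟨![a, b], ?_, ?_⟩
    · rw [Fin.strictMono_iff_lt_succ]
      intro i
      fin_cases i
      exact hlt
    · convert h using 2 <;> (funext i; fin_cases i; rfl)
  | succ n ih =>
    intro C _
    obtain ⟨N, hN⟩ := ih (Set C)
    refine ⟨N, fun f => ?_⟩
    -- Colour `x` by the set of colours of its increasing one-step extensions. If both windows of
    -- `w` get the same set, some extension `z` of the second has the colour of `w`, and `w 0` can
    -- be prepended to `z`.
    obtain ⟨w, hw, h⟩ := hN fun x => {c | ∃ z : Fin (n + 2) → Fin N, StrictMono z ∧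
      (fun i : Fin (n + 1) => z i.castSucc) = x ∧ f z = c}
    have hmem : f w ∈ {c | ∃ z : Fin (n + 2) → Fin N, StrictMono z ∧
        (fun i : Fin (n + 1) => z i.castSucc) = (fun i => w i.castSucc) ∧ f z = c} :=
      ⟨w, hw, rfl, rfl⟩
    rw [h] at hmem
    obtain ⟨z, hz, hzw, hf⟩ := hmem
    refine ⟨Fin.cons (w 0) z, ?_, ?_⟩
    · rw [Fin.strictMono_iff_lt_succ]
      intro i
      refine Fin.cases ?_ (fun i => ?_) i
      · have : z 0 = w 1 := congrFun hzw 0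
        simp only [Fin.castSucc_zero, Fin.cons_zero, Fin.cons_succ, this]
        exact hw Fin.zero_lt_one
      · rw [← Fin.succ_castSucc, Fin.cons_succ, Fin.cons_succ]
        exact hz i.castSucc_lt_succ
    · have h1 : (fun i => (Fin.cons (w 0) z : Fin (n + 3) → Fin N) i.castSucc) = w := by
        funext i
        refine Fin.cases ?_ (fun i => ?_) i
        · simp
        · rw [← Fin.succ_castSucc, Fin.cons_succ]
          exact congrFun hzw i
      have h2 : (fun i : Fin (n + 2) => (Fin.cons (w 0) z : Fin (n + 3) → Fin N) i.succ) = z := by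
        funext i
        simp
      rw [h1, h2, hf]

/-- The vertices of the shift graph: `n`-tuples over `Fin N`. -/
def ShiftVertex (n N : ℕ) : Type := Fin n → Fin N

instance (n N : ℕ) : DecidableEq (ShiftVertex n N) :=
  inferInstanceAs (DecidableEq (Fin n → Fin N))

instance (n N : ℕ) : Finite (ShiftVertex n N) :=
  inferInstanceAs (Finite (Fin n → Fin N))

/-- Two vertices are joined if they are the windows of a strictly increasing `(n + 1)`-tuple. -/
def ShiftAdj {n N : ℕ} (x y : ShiftVertex n N) : Prop :=
  ∃ z : Fin (n + 1) → Fin N, StrictMono z ∧ x = (fun i => z i.castSucc) ∧ y = fun i => z i.succ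

instance shiftStructure (n N : ℕ) : Language.graph.Structure (ShiftVertex n N) where
  funMap := fun f => nomatch f
  RelMap | .adj => fun x => ShiftAdj (x 0) (x 1)

theorem exists_not_homTo_clique (n d : ℕ) (hn : 0 < n) :
    ∃ N : ℕ, ¬ HomTo Language.graph (ShiftVertex n N) (Clique d) := by
  obtain ⟨n, rfl⟩ : ∃ m, n = m + 1 := ⟨n - 1, by lia⟩
  obtain ⟨N, hN⟩ := exists_strictMono_window_eq n (Fin d)
  refine ⟨N, fun ⟨f⟩ => ?_⟩
  obtain ⟨z, hz, h⟩ := hN f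
  let x : Fin 2 → ShiftVertex (n + 1) N := ![fun i => z i.castSucc, fun i => z i.succ]
  have hx : RelMap (L := Language.graph) adj x := ⟨z, hz, rfl, rfl⟩
  exact f.map_rel adj x hx h

/-! ### Local distributions from random permutations -/

/-- The set of all entries of the tuples in `V`. -/
def support {n N : ℕ} (V : Finset (ShiftVertex n N)) : Finset (Fin N) :=
  V.biUnion fun x => Finset.univ.image x

theorem support_mono {n N : ℕ} {U V : Finset (ShiftVertex n N)} (h : U ⊆ V) :
    support U ⊆ support V :=
  Finset.biUnion_subset_biUnion_of_subset_left _ h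

theorem mem_support {n N : ℕ} {V : Finset (ShiftVertex n N)} {x : ShiftVertex n N} (hx : x ∈ V)
    (i : Fin n) : x i ∈ support V :=
  Finset.mem_biUnion.mpr ⟨x, hx, Finset.mem_image_of_mem _ (Finset.mem_univ i)⟩

theorem card_support_le {n N : ℕ} (V : Finset (ShiftVertex n N)) :
    (support V).card ≤ V.card * n :=
  Finset.card_biUnion_le_card_mul _ _ _ fun _ _ =>
    Finset.card_image_le.trans_eq (Finset.card_fin n)

section LocalColoring

variable {n N M : ℕ} {A : Type} [DecidableEq A]

/-- The colouring of `V` obtained by renaming entries along `j`, permuting them by `π` and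
applying `φ`. -/
def localColoring (φ : (Fin n → Fin M) → A) (j : Fin N → Fin M) (V : Finset (ShiftVertex n N))
    (π : Equiv.Perm (Fin M)) : V → A :=
  fun v => φ fun i => π (j (v.1 i))

/-- The probability that a uniformly random permutation induces the colouring `f` of `V`. -/
noncomputable def localProb (φ : (Fin n → Fin M) → A) (j : Fin N → Fin M)
    (V : Finset (ShiftVertex n N)) (f : V → A) : ℝ :=
  (∑ π : Equiv.Perm (Fin M), if localColoring φ j V π = f then (1 : ℝ) else 0) /
    Fintype.card (Equiv.Perm (Fin M))

theorem localProb_nonneg (φ : (Fin n → Fin M) → A) (j : Fin N → Fin M)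
    (V : Finset (ShiftVertex n N)) (f : V → A) : 0 ≤ localProb φ j V f :=
  div_nonneg (Finset.sum_nonneg fun _ _ => by split_ifs <;> simp) (Nat.cast_nonneg _)

theorem localProb_le_one (φ : (Fin n → Fin M) → A) (j : Fin N → Fin M)
    (V : Finset (ShiftVertex n N)) (f : V → A) : localProb φ j V f ≤ 1 := by
  refine div_le_one_of_le₀ ?_ (Nat.cast_nonneg _)
  rw [Finset.sum_boole]
  exact_mod_cast Finset.card_le_univ _

theorem sum_localProb [Fintype A] (φ : (Fin n → Fin M) → A) (j : Fin N → Fin M)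
    (V : Finset (ShiftVertex n N)) : ∑ f : V → A, localProb φ j V f = 1 := by
  have h : (Fintype.card (Equiv.Perm (Fin M)) : ℝ) ≠ 0 := Nat.cast_ne_zero.mpr Fintype.card_ne_zero
  simp only [localProb]
  rw [← Finset.sum_div, Finset.sum_comm, div_eq_one_iff_eq h]
  simp

/-- Marginals of the local distribution given by `j` are given by the same `j`. -/
theorem localProb_eq_sum_restr [Fintype A] (φ : (Fin n → Fin M) → A) (j : Fin N → Fin M)
    {U V : Finset (ShiftVertex n N)} (h : U ⊆ V) (f : U → A) :
    localProb φ j U f = ∑ g : V → A with restr h g = f, localProb φ j V g := by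
  simp only [localProb]
  rw [← Finset.sum_div, Finset.sum_comm]
  congr 1
  refine Finset.sum_congr rfl fun π _ => ?_
  rw [Finset.sum_ite_eq]
  simp only [Finset.mem_filter, Finset.mem_univ, true_and]
  rfl

/-- The local distribution does not depend on the injective renaming of entries. -/
theorem localProb_congr (φ : (Fin n → Fin M) → A) {j j' : Fin N → Fin M}
    {V : Finset (ShiftVertex n N)} (hj : Set.InjOn j (support V))
    (hj' : Set.InjOn j' (support V)) (f : V → A) : localProb φ j V f = localProb φ j' V f := by
  -- A permutation `τ` carries `j` to `j'` on the support, and `π ↦ π * τ` preserves the uniform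
  -- distribution.
  obtain ⟨τ, hτ⟩ := Equiv.Perm.exists_extending_pair _ _ hj.injective hj'.injective
  simp only [localProb]
  congr 1
  rw [← Equiv.sum_comp (Equiv.mulRight τ)]
  refine Finset.sum_congr rfl fun π _ => ?_
  have : localColoring φ j V (Equiv.mulRight τ π) = localColoring φ j' V π := by
    funext v
    simp only [localColoring, Equiv.coe_mulRight, Equiv.Perm.mul_apply]
    congr 1
    funext i
    exact congrArg π (hτ ⟨v.1 i, mem_support v.2 i⟩)
  rw [this]

theorem localProb_eq_zero (φ : (Fin n → Fin M) → A) (j : Fin N → Fin M)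
    (V : Finset (ShiftVertex n N)) (f : V → A) (h : ∀ π, localColoring φ j V π ≠ f) :
    localProb φ j V f = 0 := by
  simp [localProb, h]

end LocalColoring

theorem exists_injOn_fin {N M : ℕ} (S : Finset (Fin N)) (hM : 0 < M) (h : S.card ≤ M) :
    ∃ j : Fin N → Fin M, Set.InjOn j S := by
  have : Nonempty (Fin M) := ⟨⟨0, hM⟩⟩
  obtain ⟨j, -, hj⟩ := S.finite_toSet.exists_injOn_of_encard_le (t := (Set.univ : Set (Fin M)))
    (by simpa using h)
  exact ⟨j, hj⟩

/-- The bound `k + 2` covers both the sets of size at most `k` and the at most two endpoints of an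
edge. -/
theorem accepts_shiftVertex {n M c : ℕ} (k N : ℕ) (hn : 0 < n) (hkM : (k + 2) * n ≤ M)
    (h : ShiftColorable n M (Fin c)) :
    Accepts Language.graph k (ShiftVertex n N) (Clique c) := by
  obtain ⟨φ, hφ⟩ := h
  have hM : 0 < M := lt_of_lt_of_le (by positivity) hkM
  have hex : ∀ V : Finset (ShiftVertex n N), ∃ j : Fin N → Fin M,
      V.card ≤ k + 2 → Set.InjOn j (support V) := by
    intro V
    by_cases hV : V.card ≤ k + 2
    · obtain ⟨j, hj⟩ := exists_injOn_fin (support V) hM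
        ((card_support_le V).trans ((Nat.mul_le_mul_right n hV).trans hkM))
      exact ⟨j, fun _ => hj⟩
    · exact ⟨fun _ => ⟨0, hM⟩, fun h => absurd h hV⟩
  choose j hj using hex
  have hmarg : ∀ (U V : Finset (ShiftVertex n N)) (h : U ⊆ V), V.card ≤ k + 2 →
      ∀ f : U → Clique c,
        localProb φ (j U) U f = ∑ g : V → Clique c with restr h g = f, localProb φ (j V) V g := by
    intro U V h hV f
    rw [← localProb_eq_sum_restr φ (j V) h f]
    exact localProb_congr φ (hj U ((Finset.card_le_card h).trans hV))
      ((hj V hV).mono (Finset.coe_subset.mpr (support_mono h))) f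
  have hentries : ∀ x : Fin 2 → ShiftVertex n N, (entries x).card ≤ k + 2 := fun x =>
    Finset.card_image_le.trans (by simp)
  refine ⟨fun V f => localProb φ (j V) V f, fun _ x f => localProb φ (j (entries x)) (entries x) f,
    fun V _ _ f => ⟨localProb_nonneg .., localProb_le_one ..⟩,
    fun _ x _ f => ⟨localProb_nonneg .., localProb_le_one ..⟩,
    fun V _ _ => sum_localProb .., fun U V h _ hV f => hmarg U V h (by lia) f, ?_, ?_⟩
  · intro m R x _ U h _ _ f
    cases R
    exact hmarg U _ h (hentries x) f
  · intro m R x hx f hf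
    cases R
    obtain ⟨z, hz, h0, h1⟩ := hx
    refine localProb_eq_zero _ _ _ _ fun π hπ => hf ?_
    subst hπ
    have hmem : ∀ i, z i ∈ support (entries x) := by
      intro i
      refine Fin.lastCases ?_ (fun i => ?_) i
      -- The last entry of `z` occurs only in the second window, at index `n - 1`; this needs `0 <
      -- n`.
      · have := mem_support (mem_entries x 1) ⟨n - 1, by lia⟩
        rw [h1] at this
        convert this using 2
        ext
        simp only [Fin.val_last, Fin.val_succ]
        lia
      · have := mem_support (mem_entries x 0) i
        rwa [h0] at this
    have hinj : Function.Injective fun i => π (j (entries x) (z i)) := fun a b hab =>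
      hz.injective (hj _ (hentries x) (hmem a) (hmem b) (π.injective hab))
    have := hφ _ hinj
    change φ (fun i => π (j _ (x 0 i))) ≠ φ (fun i => π (j _ (x 1 i)))
    rw [h0, h1]
    exact this

end SheraliAdams

theorem mainTheorem2 (c d : ℕ) (hc : 3 ≤ c) (hcd : c ≤ d) :
    ¬ ∃ k : ℕ, 1 ≤ k ∧
      SheraliAdams.Solves Language.graph k (SheraliAdams.Clique c) (SheraliAdams.Clique d) := by
  rintro ⟨k, -, hk⟩
  obtain ⟨n, M, hn, hM, hcol⟩ := SheraliAdams.exists_shiftColorable_three (k + 2)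
  obtain ⟨N, hN⟩ := SheraliAdams.exists_not_homTo_clique n d hn
  exact hN ((hk (SheraliAdams.ShiftVertex n N) (Or.inr hN)).2
    (SheraliAdams.accepts_shiftVertex k N hn hM
      (hcol.comp (Fin.castLE_injective hc))))
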